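/- Let $m,n,r,s$ be non-negative integers with $r<s\le\min\{m,n\}$. Let $M^s_{m,n}\subset\mathbb C^{m\times n}$ be the generic determinantal variety, i.e. the common zero locus of all $s$-minors, which is the set of matrices of rank $<s$, and let $V^r_{m,n}\subset M^s_{m,n}$ be the stratum of the rank stratification consisting of the matrices of rank exactly $r$. For a complex analytic subvariety $V$ of a complex vector space $E$ and $q\in V$, let $I(V)_q$ be the ideal of germs at $q$ of holomorphic functions vanishing on $V$, and let $\mathrm{Der}(-\log V)_q$ be the module of germs at $q$ of holomorphic vector fields $\xi$ with $\xi(I(V)_q)\subset I(V)_q$. The logarithmic tangent space is $T^{\log}_qV=\{\xi(q):\xi\in\mathrm{Der}(-\log V)_q\}\subset T_qE=E$. A complex submanifold $S\subset V$ is called a holonomic stratum of $V$ if $T^{\log}_qV=T_qS$ for every $q\in S$. Then $V^r_{m,n}$ is a complex submanifold of $\mathbb C^{m\times n}$ and a holonomic stratum of $M^s_{m,n}$: $$T^{\log}_\varphi M^s_{m,n}=T_\varphi V^r_{m,n}\qquad\text{for every }\varphi\in V^r_{m,n}.$$ -/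

import Mathlib

open Filter Topology

/- The space of matrices is normed by the sup norm of the entries; all norms on it are
equivalent, so that holomorphy, germs and derivatives do not depend on the choice. -/
attribute [local instance] Matrix.normedAddCommGroup Matrix.normedSpace

section Logarithmic

variable {E : Type*} [NormedAddCommGroup E] [NormedSpace ℂ E]

/-- Representatives of the germs in the stalk `I(V)_q`: the functions that are holomorphic near `q`
and vanish on `V` near `q`. -/
def vanishingIdealAt (V : Set E) (q : E) : Set (E → ℂ) :=
  {f | AnalyticAt ℂ f q ∧ ∀ᶠ x in 𝓝 q, x ∈ V → f x = 0}

/-- `ξ(f)`, the derivative of the function `f` along the vector field `ξ`. -/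
noncomputable def lieDerivative (ξ : E → E) (f : E → ℂ) : E → ℂ :=
  fun x => fderiv ℂ f x (ξ x)

/-- `Der(-log V)` at `q`: the (representatives of germs of) vector fields `ξ`, holomorphic near `q`,
with `ξ(I(V)_q) ⊆ I(V)_q`. -/
noncomputable def logDer (V : Set E) (q : E) : Submodule ℂ (E → E) where
  carrier := {ξ | AnalyticAt ℂ ξ q ∧
    ∀ f ∈ vanishingIdealAt V q, lieDerivative ξ f ∈ vanishingIdealAt V q}
  zero_mem' := by
    refine ⟨analyticAt_const, fun f _ => ?_⟩
    have h : lieDerivative (0 : E → E) f = fun _ => 0 := by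
      funext x
      simp [lieDerivative]
    rw [h]
    exact ⟨analyticAt_const, Eventually.of_forall fun _ _ => rfl⟩
  add_mem' := by
    rintro ξ η ⟨hξ, hξ'⟩ ⟨hη, hη'⟩
    refine ⟨hξ.add hη, fun f hf => ?_⟩
    have h : lieDerivative (ξ + η) f = lieDerivative ξ f + lieDerivative η f := by
      funext x
      simp [lieDerivative]
    rw [h]
    refine ⟨(hξ' f hf).1.add (hη' f hf).1, ?_⟩
    filter_upwards [(hξ' f hf).2, (hη' f hf).2] with x h1 h2 hx
    simp [h1 hx, h2 hx]
  smul_mem' := by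
    rintro c ξ ⟨hξ, hξ'⟩
    refine ⟨analyticAt_const.smul hξ, fun f hf => ?_⟩
    have h : lieDerivative (c • ξ) f = (fun _ => c) * lieDerivative ξ f := by
      funext x
      simp [lieDerivative]
    rw [h]
    refine ⟨analyticAt_const.mul (hξ' f hf).1, ?_⟩
    filter_upwards [(hξ' f hf).2] with x h1 hx
    simp [h1 hx]

/-- The logarithmic tangent space `T^log_q V`, the image of `Der(-log V)` at `q` in the ambient
tangent space under `ξ ↦ ξ(q)`, i.e. the vectors that extend locally to logarithmic vector
fields for `V`. -/
noncomputable def logTangentSpace (V : Set E) (q : E) : Submodule ℂ E :=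
  (logDer V q).map (LinearMap.proj q)

/-- `S` is a (locally closed, embedded) complex submanifold: near each of its points it is the zero
set of a holomorphic submersion to some `ℂ^k`. -/
def IsComplexSubmanifold (S : Set E) : Prop :=
  ∀ q ∈ S, ∃ (k : ℕ) (h : E → (Fin k → ℂ)), AnalyticAt ℂ h q ∧
    Function.Surjective (fderiv ℂ h q) ∧ ∀ᶠ x in 𝓝 q, x ∈ S ↔ h x = 0

/-- The tangent space `T_q S` of a complex submanifold `S` at `q`, as the set of the velocities
at time `0` of germs of holomorphic curves in `S` through `q`. -/
def tangentVectors (S : Set E) (q : E) : Set E :=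
  {v | ∃ γ : ℂ → E, AnalyticAt ℂ γ 0 ∧ γ 0 = q ∧ (∀ᶠ t in 𝓝 0, γ t ∈ S) ∧ deriv γ 0 = v}

/-- The complex submanifold `S` is a holonomic stratum of `V`: at each of its points `q` one has
`T^log_q V = T_q S`. -/
structure IsHolonomicStratum (V S : Set E) : Prop where
  subset : S ⊆ V
  submanifold : IsComplexSubmanifold S
  logTangentSpace_eq : ∀ q ∈ S, (logTangentSpace V q : Set E) = tangentVectors S q

end Logarithmic

/-- The generic determinantal variety `M^s_{m,n}`, the common zero locus of the `s`-minors. -/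
def genericDeterminantalVariety (m n s : ℕ) : Set (Matrix (Fin m) (Fin n) ℂ) :=
  {φ | ∀ (i : Fin s ↪o Fin m) (j : Fin s ↪o Fin n), (φ.submatrix i j).det = 0}

/-- The stratum `V^r_{m,n}` of the rank stratification: the matrices of rank `r`. -/
def rankStratum (m n r : ℕ) : Set (Matrix (Fin m) (Fin n) ℂ) :=
  {φ | φ.rank = r}

/-!
Let `G = GL_m × GL_n` act on the `m × n` matrices by left and right multiplication. The rank
stratum through `q` is the orbit of `q`, so that its tangent space should be the space of the
matrices `X q + q Y`; the logarithmic tangent space of the determinantal variety is shown to be the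
same space.

In a normal form `q = P [1 0; 0 0] Q` (`exists_rankNormalForm`), a matrix `v` is of the form
`X q + q Y` as soon as the lower right block of `P⁻¹ v Q⁻¹` vanishes
(`RankNormalForm.exists_eq_mul_add_mul`). Four facts remain.

* Every `X q + q Y` is tangent to the stratum, being the velocity of the curve
  `(1 + t X) q (1 + t Y)`, along which the rank is constant (`mul_add_mul_mem_tangentVectors`).
* Every `X q + q Y` is logarithmic: the vector field `x ↦ X x + x Y` is tangent to such curves
  through all points, and these stay in the determinantal variety
  (`mul_add_mul_mem_logTangentSpace`).
* The `(r + 1)`-minors that border the upper left block of `P⁻¹ x Q⁻¹` cut out the stratum near `q`,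
  and their differentials at `q` are the entries of the lower right block of `P⁻¹ v Q⁻¹`
  (`RankNormalForm.fderiv_borderedMinor`). So the stratum is a submanifold, and these entries vanish
  for tangent vectors.
* These entries also vanish at `v = ξ(q)` for a logarithmic field `ξ`
  (`RankNormalForm.entry_eq_zero_of_mem_logTangentSpace`). The matrix `q` is the limit at `t = 0` of
  a line of matrices `x t` that have, in the coordinates of the normal form, the entry `1` at `r`
  places and the entry `t` at `s - 1 - r` further ones, all in different rows and columns, and `0`
  elsewhere. They have rank less than `s`, so that `ξ(f)` vanishes at `x t` for every `s`-minor `f`.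
  If `f` is the minor on the rows and columns of these places and the row `i` and column `j`, then
  its derivative at `x t` along `ξ (x t)` is `t ^ (s - 1 - r)` times the entry of
  `P⁻¹ ξ(x t) Q⁻¹` at `(i, j)`. Hence that entry vanishes for small `t ≠ 0`, and at `t = 0` by
  continuity. In this way the case `s > r + 1`, in which all `s`-minors are singular at `q`, is
  reduced to smooth points of the variety.
-/

/-! ### Rank normal form and minors -/

/-- A normal form `q = P [1 0; 0 0] Q` with an identity block of size `r`, where `P` and `Q` are
invertible. The inverses `P'` and `Q'` are part of the data, and the row and column indices are split
into the first `r` and the others. -/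
structure RankNormalForm {m n : ℕ} (r : ℕ) (q : Matrix (Fin m) (Fin n) ℂ) where
  P : Matrix (Fin m) (Fin r ⊕ Fin (m - r)) ℂ
  P' : Matrix (Fin r ⊕ Fin (m - r)) (Fin m) ℂ
  Q : Matrix (Fin r ⊕ Fin (n - r)) (Fin n) ℂ
  Q' : Matrix (Fin n) (Fin r ⊕ Fin (n - r)) ℂ
  P_mul_P' : P * P' = 1
  P'_mul_P : P' * P = 1
  Q_mul_Q' : Q * Q' = 1
  Q'_mul_Q : Q' * Q = 1
  eq : q = P *
    (Matrix.fromBlocks 1 0 0 0 : Matrix (Fin r ⊕ Fin (m - r)) (Fin r ⊕ Fin (n - r)) ℂ) * Q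

theorem exists_rankNormalForm {m n : ℕ} (q : Matrix (Fin m) (Fin n) ℂ) :
    Nonempty (RankNormalForm q.rank q) := by
  set f := Matrix.toLin' q with hf
  obtain ⟨C, hC⟩ := Submodule.exists_isCompl (LinearMap.ker f)
  obtain ⟨W, hW⟩ := Submodule.exists_isCompl (LinearMap.range f)
  have hr : Module.finrank ℂ (LinearMap.range f) = q.rank := rfl
  have hker : Module.finrank ℂ (LinearMap.ker f) = n - q.rank := by
    have := LinearMap.finrank_range_add_finrank_ker f
    rw [Module.finrank_fin_fun] at this
    omega
  have hWr : Module.finrank ℂ W = m - q.rank := by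
    have := Submodule.finrank_add_eq_of_isCompl hW
    rw [Module.finrank_fin_fun] at this
    omega
  let e := LinearMap.kerComplementEquivRange f hC.symm
  let bR : Module.Basis (Fin q.rank) ℂ (LinearMap.range f) := Module.finBasisOfFinrankEq _ _ hr
  let bK : Module.Basis (Fin (n - q.rank)) ℂ (LinearMap.ker f) :=
    Module.finBasisOfFinrankEq _ _ hker
  let bW : Module.Basis (Fin (m - q.rank)) ℂ W := Module.finBasisOfFinrankEq _ _ hWr
  let b := ((bR.map e.symm).prod bK).map (Submodule.prodEquivOfIsCompl _ _ hC.symm)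
  let c := (bR.prod bW).map (Submodule.prodEquivOfIsCompl _ _ hW)
  have hbl (l) : f (b (Sum.inl l)) = c (Sum.inl l) := by
    have h1 : e (e.symm (bR l)) = bR l := e.apply_symm_apply _
    have h2 := congrArg Subtype.val h1
    simpa [b, c, e] using h2
  have hbr (l) : f (b (Sum.inr l)) = 0 := by
    simp [b]
  have hM : LinearMap.toMatrix b c f = Matrix.fromBlocks 1 0 0 0 := by
    ext i j
    rw [LinearMap.toMatrix_apply]
    rcases j with j | j
    · rw [hbl, Module.Basis.repr_self]
      rcases i with i | i <;> simp [Matrix.one_apply, Finsupp.single_apply, eq_comm]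
    · rw [hbr]
      rcases i with i | i <;> simp
  refine ⟨(Pi.basisFun ℂ (Fin m)).toMatrix c, c.toMatrix (Pi.basisFun ℂ (Fin m)),
    b.toMatrix (Pi.basisFun ℂ (Fin n)), (Pi.basisFun ℂ (Fin n)).toMatrix b,
    Module.Basis.toMatrix_mul_toMatrix_flip _ _, Module.Basis.toMatrix_mul_toMatrix_flip _ _,
    Module.Basis.toMatrix_mul_toMatrix_flip _ _, Module.Basis.toMatrix_mul_toMatrix_flip _ _, ?_⟩
  rw [← hM, basis_toMatrix_mul_linearMap_toMatrix_mul_basis_toMatrix, hf]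
  ext i j
  simp [LinearMap.toMatrix_apply]

/-- A matrix of rank at least `s` has `s` linearly independent rows, taken in increasing order. -/
theorem Matrix.exists_orderEmbedding_linearIndependent_row {m s : ℕ} {N : Type*} [Fintype N]
    (A : Matrix (Fin m) N ℂ) (h : s ≤ A.rank) :
    ∃ i : Fin s ↪o Fin m, LinearIndependent ℂ (A.submatrix i id).row := by
  classical
  obtain ⟨t, -, -, ht, hli⟩ := exists_linearIndepOn_extension
    (v := A.row) (linearIndepOn_empty ℂ A.row) (Set.empty_subset Set.univ)
  have hspan : Submodule.span ℂ (A.row '' t) = Submodule.span ℂ (Set.range A.row) := by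
    refine le_antisymm (Submodule.span_mono (Set.image_subset_range _ _)) ?_
    rw [Submodule.span_le, ← Set.image_univ]
    exact ht
  have hcard : s ≤ t.toFinset.card := by
    have h1 := finrank_span_eq_card hli
    rw [Matrix.rank_eq_finrank_span_row, ← hspan] at h
    have h2 : Set.range (fun x : t => A.row x) = A.row '' t := by
      ext; simp
    rw [h2] at h1
    rw [h1] at h
    simpa using h
  obtain ⟨u, hut, hu⟩ := Finset.exists_subset_card_eq hcard
  refine ⟨u.orderEmbOfFin hu, ?_⟩
  have hmem (k : Fin s) : u.orderEmbOfFin hu k ∈ t := by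
    simpa using hut (u.orderEmbOfFin_mem hu k)
  exact hli.linearIndependent.comp (fun k => ⟨u.orderEmbOfFin hu k, hmem k⟩)
    (fun k l hkl => (u.orderEmbOfFin hu).injective (Subtype.mk.inj hkl))

/-- The minors of the definition, taken on increasing rows and columns, suffice to detect the rank. -/
theorem mem_genericDeterminantalVariety_iff {m n s : ℕ} {φ : Matrix (Fin m) (Fin n) ℂ} :
    φ ∈ genericDeterminantalVariety m n s ↔ φ.rank < s := by
  constructor
  · intro h
    by_contra! hs
    obtain ⟨i, hi⟩ := φ.exists_orderEmbedding_linearIndependent_row hs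
    have hrk : s ≤ ((φ.submatrix i id).transpose).rank := by
      rw [Matrix.rank_transpose, LinearIndependent.rank_matrix hi, Fintype.card_fin]
    obtain ⟨j, hj⟩ := Matrix.exists_orderEmbedding_linearIndependent_row _ hrk
    have hu := (Matrix.isUnit_iff_isUnit_det _).1 (Matrix.linearIndependent_rows_iff_isUnit.1 hj)
    rw [Matrix.transpose_submatrix, Matrix.submatrix_submatrix, ← Matrix.transpose_submatrix,
      Matrix.det_transpose] at hu
    exact hu.ne_zero (h i j)
  · intro h i j
    by_contra hdet
    have h1 := Matrix.rank_of_det_ne_zero hdet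
    have h2 := φ.rank_submatrix_le i j
    rw [h1, Fintype.card_fin] at h2
    omega

/-- If the upper left `r × r` block is invertible, then the bordered minors are, up to the
determinant of that block, the entries of its Schur complement, which vanishes if and only if the
matrix has rank `r`. -/
theorem Matrix.rank_eq_iff_borderedMinor_eq_zero {r : ℕ} {α β : Type*} [Fintype α] [Fintype β]
    (x : Matrix (Fin r ⊕ α) (Fin r ⊕ β) ℂ) (hx : x.toBlocks₁₁.det ≠ 0) :
    x.rank = r ↔ ∀ i j, (x.submatrix (Sum.elim Sum.inl fun _ : Unit => Sum.inr i)
      (Sum.elim Sum.inl fun _ : Unit => Sum.inr j)).det = 0 := by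
  classical
  constructor
  · intro h i j
    by_contra hdet
    have h1 := Matrix.rank_of_det_ne_zero hdet
    have h2 := x.rank_submatrix_le (Sum.elim Sum.inl fun _ : Unit => Sum.inr i)
      (Sum.elim Sum.inl fun _ : Unit => Sum.inr j)
    rw [h1, Fintype.card_sum, Fintype.card_fin, Fintype.card_unit] at h2
    omega
  · intro h
    let _ := Matrix.invertibleOfIsUnitDet x.toBlocks₁₁ (isUnit_iff_ne_zero.2 hx)
    apply le_antisymm
    · have hD : x.toBlocks₂₂ = x.toBlocks₂₁ * ⅟x.toBlocks₁₁ * x.toBlocks₁₂ := by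
        ext i j
        have hij := h i j
        have : x.submatrix (Sum.elim Sum.inl fun _ : Unit => Sum.inr i)
            (Sum.elim Sum.inl fun _ : Unit => Sum.inr j) =
            Matrix.fromBlocks x.toBlocks₁₁ (x.toBlocks₁₂.submatrix id fun _ => j)
              (x.toBlocks₂₁.submatrix (fun _ => i) id)
              (x.toBlocks₂₂.submatrix (fun _ => i) fun _ => j) := by
          ext (a | a) (b | b) <;> rfl
        rw [this, Matrix.det_fromBlocks₁₁, mul_eq_zero, or_iff_right hx,
          Matrix.det_unique, Matrix.sub_apply, sub_eq_zero] at hij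
        exact hij
      -- With zero Schur complement, `x` factors through a space of dimension `r`.
      have hfac : x = Matrix.fromRows 1 (x.toBlocks₂₁ * ⅟x.toBlocks₁₁) *
          Matrix.fromCols x.toBlocks₁₁ x.toBlocks₁₂ := by
        rw [Matrix.fromRows_mul_fromCols]
        conv_lhs => rw [← x.fromBlocks_toBlocks, hD]
        simp
      rw [hfac]
      refine (Matrix.rank_mul_le_right _ _).trans ((Matrix.rank_le_card_height _).trans ?_)
      simp
    · have h1 := Matrix.rank_of_det_ne_zero hx
      rw [Fintype.card_fin] at h1
      exact h1.symm.le.trans (x.rank_submatrix_le Sum.inl Sum.inl)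

/-- The left-hand side is the derivative of the determinant at `diagonal d` along `U`. If `d` has a
zero at `o`, then only the entry of `U` at `(o, o)` contributes. -/
theorem Matrix.sum_det_updateRow_diagonal {κ : Type*} [Fintype κ] [DecidableEq κ] (d : κ → ℂ)
    (o : κ) (ho : d o = 0) (U : Matrix κ κ ℂ) :
    ∑ k, ((Matrix.diagonal d).updateRow k (U k)).det =
      (∏ k ∈ Finset.univ.erase o, d k) * U o o := by
  have h (k : κ) : ((Matrix.diagonal d).updateRow k (U k)).det =
      (∏ l ∈ Finset.univ.erase k, d l) * U k k := by
    rw [Matrix.det_eq_sum_mul_adjugate_row _ k]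
    simp_rw [Matrix.adjugate_apply, Matrix.updateRow_idem, ← Matrix.adjugate_apply,
      Matrix.adjugate_diagonal, Matrix.updateRow_self, Matrix.diagonal_apply]
    simp [mul_comm]
  simp_rw [h]
  refine Finset.sum_eq_single o (fun k _ hk => ?_) (by simp)
  rw [Finset.prod_eq_zero (Finset.mem_erase.2 ⟨hk.symm, Finset.mem_univ o⟩) ho, zero_mul]

/-! ### The derivative of a minor -/

section Minors

variable {μ ν κ : Type*} [Fintype μ] [Fintype ν] [Fintype κ] [DecidableEq κ]

/-- The determinant as a continuous multilinear function of the rows. -/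
noncomputable def Matrix.detContinuousMultilinear (κ : Type*) [Fintype κ] [DecidableEq κ] :
    ContinuousMultilinearMap ℂ (fun _ : κ => κ → ℂ) ℂ where
  toMultilinearMap := (Matrix.detRowAlternating (n := κ) (R := ℂ)).toMultilinearMap
  cont := Continuous.matrix_det continuous_id

/-- The continuous linear map `x ↦ L * x * R`, with values in the families of rows. -/
noncomputable def Matrix.mulMulCLM (L : Matrix κ μ ℂ) (R : Matrix ν κ ℂ) :
    Matrix μ ν ℂ →L[ℂ] (κ → κ → ℂ) :=
  LinearMap.toContinuousLinearMap
    { toFun := fun x => L * x * R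
      map_add' := fun x y => by rw [Matrix.mul_add, Matrix.add_mul]; rfl
      map_smul' := fun c x => by rw [Matrix.mul_smul, Matrix.smul_mul]; rfl }

theorem Matrix.det_mul_mul_eq (L : Matrix κ μ ℂ) (R : Matrix ν κ ℂ) :
    (fun x : Matrix μ ν ℂ => (L * x * R).det) =
      Matrix.detContinuousMultilinear κ ∘ Matrix.mulMulCLM L R := rfl

theorem Matrix.analyticAt_det_mul_mul (L : Matrix κ μ ℂ) (R : Matrix ν κ ℂ) (x : Matrix μ ν ℂ) :
    AnalyticAt ℂ (fun x : Matrix μ ν ℂ => (L * x * R).det) x := by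
  rw [Matrix.det_mul_mul_eq]
  exact (Matrix.detContinuousMultilinear κ).analyticAt.comp ((Matrix.mulMulCLM L R).analyticAt x)

theorem Matrix.fderiv_det_mul_mul (L : Matrix κ μ ℂ) (R : Matrix ν κ ℂ) (x v : Matrix μ ν ℂ)
    {d : κ → ℂ} (hx : L * x * R = Matrix.diagonal d) {o : κ} (ho : d o = 0) :
    fderiv ℂ (fun x : Matrix μ ν ℂ => (L * x * R).det) x v =
      (∏ k ∈ Finset.univ.erase o, d k) * (L * v * R) o o := by
  have h : HasFDerivAt (fun x : Matrix μ ν ℂ => (L * x * R).det) _ x :=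
    ((Matrix.detContinuousMultilinear κ).hasFDerivAt (x := Matrix.mulMulCLM L R x)).comp x
      (Matrix.mulMulCLM L R).hasFDerivAt
  rw [h.fderiv]
  refine ((Matrix.detContinuousMultilinear κ).linearDeriv_apply _ _).trans ?_
  rw [← Matrix.sum_det_updateRow_diagonal d o ho, ← hx]
  rfl

end Minors

/-! ### Vector fields of the group action -/

section OrbitCurve
variable {m n : ℕ}

/-- The curve through `x` that stands in for `exp (t X) x exp (t Y)`; it has the same velocity, and
is polynomial. -/
theorem orbitCurve_analyticAt_and_hasDerivAt (X : Matrix (Fin m) (Fin m) ℂ)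
    (Y : Matrix (Fin n) (Fin n) ℂ) (x : Matrix (Fin m) (Fin n) ℂ) :
    AnalyticAt ℂ (fun t : ℂ => (1 + t • X) * x * (1 + t • Y)) 0 ∧
    HasDerivAt (fun t : ℂ => (1 + t • X) * x * (1 + t • Y)) (X * x + x * Y) 0 := by
  have h : (fun t : ℂ => (1 + t • X) * x * (1 + t • Y)) =
      fun t : ℂ => x + t • (X * x + x * Y) + t ^ 2 • (X * x * Y) := by
    funext t
    simp only [Matrix.add_mul, Matrix.mul_add, Matrix.one_mul, Matrix.mul_one, Matrix.smul_mul,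
      Matrix.mul_smul, smul_add, smul_smul, pow_two]
    abel
  rw [h]
  constructor
  · fun_prop
  · have h1 := ((hasDerivAt_id (0 : ℂ)).smul_const (X * x + x * Y)).const_add x
    have h2 := ((hasDerivAt_id (0 : ℂ)).pow 2).smul_const (X * x * Y)
    exact (h1.add h2).congr_deriv (by simp)

end OrbitCurve

theorem fderiv_apply_velocity_eq_zero {E : Type*} [NormedAddCommGroup E] [NormedSpace ℂ E]
    {f : E → ℂ} {γ : ℂ → E} {t : ℂ} {v : E} (hf : DifferentiableAt ℂ f (γ t))
    (hγ : HasDerivAt γ v t) (h : ∀ᶠ u in 𝓝 t, f (γ u) = 0) : fderiv ℂ f (γ t) v = 0 := by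
  have h1 : HasDerivAt (f ∘ γ) (fderiv ℂ f (γ t) v) t := hf.hasFDerivAt.comp_hasDerivAt t hγ
  have h2 : f ∘ γ =ᶠ[𝓝 t] fun _ => 0 := h
  exact h1.unique ((hasDerivAt_const t (0 : ℂ)).congr_of_eventuallyEq h2)

theorem analyticAt_lieDerivative {E : Type*} [NormedAddCommGroup E] [NormedSpace ℂ E]
    {ξ : E → E} {f : E → ℂ} {x : E} (hξ : AnalyticAt ℂ ξ x) (hf : AnalyticAt ℂ f x) :
    AnalyticAt ℂ (lieDerivative ξ f) x :=
  ((ContinuousLinearMap.id ℂ (E →L[ℂ] ℂ)).analyticAt_bilinear _).comp₂ hf.fderiv hξ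

section Orbit
variable {m n : ℕ}

theorem eventually_rank_orbitCurve_eq (X : Matrix (Fin m) (Fin m) ℂ)
    (Y : Matrix (Fin n) (Fin n) ℂ) :
    ∀ᶠ t : ℂ in 𝓝 0, ∀ x : Matrix (Fin m) (Fin n) ℂ,
      ((1 + t • X) * x * (1 + t • Y)).rank = x.rank := by
  have h (p : ℕ) (Z : Matrix (Fin p) (Fin p) ℂ) : ∀ᶠ t : ℂ in 𝓝 0, (1 + t • Z).det ≠ 0 := by
    have hc : Continuous fun t : ℂ => (1 + t • Z).det := by fun_prop
    exact hc.continuousAt.eventually_ne (by simp)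
  filter_upwards [h m X, h n Y] with t hX hY x
  rw [Matrix.rank_mul_eq_left_of_det_ne_zero _ _ hY, Matrix.rank_mul_eq_right_of_det_ne_zero _ _ hX]

theorem mul_add_mul_mem_tangentVectors {r : ℕ} {q : Matrix (Fin m) (Fin n) ℂ}
    (hq : q ∈ rankStratum m n r) (X : Matrix (Fin m) (Fin m) ℂ) (Y : Matrix (Fin n) (Fin n) ℂ) :
    X * q + q * Y ∈ tangentVectors (rankStratum m n r) q := by
  refine ⟨fun t => (1 + t • X) * q * (1 + t • Y),
    (orbitCurve_analyticAt_and_hasDerivAt X Y q).1, by simp, ?_,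
    (orbitCurve_analyticAt_and_hasDerivAt X Y q).2.deriv⟩
  filter_upwards [eventually_rank_orbitCurve_eq X Y] with t ht
  exact (ht q).trans hq

/-- The linear vector field `x ↦ X * x + x * Y` is logarithmic for the determinantal variety. -/
theorem mul_add_mul_mem_logTangentSpace {s : ℕ} (q : Matrix (Fin m) (Fin n) ℂ)
    (X : Matrix (Fin m) (Fin m) ℂ) (Y : Matrix (Fin n) (Fin n) ℂ) :
    X * q + q * Y ∈ logTangentSpace (genericDeterminantalVariety m n s) q := by
  let ξ : Matrix (Fin m) (Fin n) ℂ →L[ℂ] Matrix (Fin m) (Fin n) ℂ :=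
    LinearMap.toContinuousLinearMap
      { toFun := fun x => X * x + x * Y
        map_add' := fun x y => by rw [Matrix.mul_add, Matrix.add_mul]; abel
        map_smul' := fun c x => by simp }
  have hξ (x) : ξ x = X * x + x * Y := rfl
  refine ⟨ξ, ⟨ξ.analyticAt q, ?_⟩, rfl⟩
  rintro f ⟨hf, hfV⟩
  refine ⟨?_, ?_⟩
  · exact analyticAt_lieDerivative (ξ.analyticAt q) hf
  · filter_upwards [hf.eventually_analyticAt, hfV.eventually_nhds] with x hx hfx hxV
    have hγ := orbitCurve_analyticAt_and_hasDerivAt X Y x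
    set γ := fun t : ℂ => (1 + t • X) * x * (1 + t • Y) with hγ_def
    have h0 : γ 0 = x := by simp [hγ_def]
    have hlim : Tendsto γ (𝓝 0) (𝓝 x) := by
      have := hγ.1.continuousAt.tendsto
      rwa [h0] at this
    have := fderiv_apply_velocity_eq_zero (f := f) (by rw [h0]; exact hx.differentiableAt)
      hγ.2 (by
        filter_upwards [hlim.eventually hfx, eventually_rank_orbitCurve_eq X Y] with t ht hrk
        refine ht (mem_genericDeterminantalVariety_iff.2 ?_)
        rw [hγ_def, hrk x]
        exact mem_genericDeterminantalVariety_iff.1 hxV)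
    rw [h0] at this
    exact this

end Orbit

/-! ### Minors in normal form coordinates -/

/-- Row (or column) indices that keep the first `r` indices, continue with `k` further ones, and
end with a prescribed index `i`. -/
theorem exists_injective_index {r k N : ℕ} (i : Fin N) (hk : k < N) :
    ∃ ρ : Fin r ⊕ (Fin k ⊕ Unit) → Fin r ⊕ Fin N, Function.Injective ρ ∧
      (∀ a, ρ (Sum.inl a) = Sum.inl a) ∧
      ρ (Sum.inr (Sum.inr ())) = Sum.inr i := by
  obtain ⟨α⟩ : Nonempty (Fin k ↪ {a : Fin N // a ≠ i}) := by
    apply Function.Embedding.nonempty_of_card_le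
    simp
    omega
  refine ⟨Sum.map id (Sum.elim (fun l => (α l : Fin N)) fun _ => i), ?_, fun _ => rfl,
    rfl⟩
  refine Function.injective_id.sumMap ?_
  exact (Subtype.val_injective.comp α.injective).sumElim (fun _ _ _ => rfl) fun a _ => (α a).2

namespace RankNormalForm
variable {m n r : ℕ} {q : Matrix (Fin m) (Fin n) ℂ} (F : RankNormalForm r q)

theorem rank_P'_mul_mul_Q' (x : Matrix (Fin m) (Fin n) ℂ) : (F.P' * x * F.Q').rank = x.rank := by
  refine le_antisymm ((Matrix.rank_mul_le_left _ _).trans (Matrix.rank_mul_le_right _ _)) ?_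
  have h : x = F.P * (F.P' * x * F.Q') * F.Q := by
    simp only [Matrix.mul_assoc, F.Q'_mul_Q, Matrix.mul_one]
    rw [← Matrix.mul_assoc, F.P_mul_P', Matrix.one_mul]
  conv_lhs => rw [h]
  exact (Matrix.rank_mul_le_left _ _).trans (Matrix.rank_mul_le_right _ _)

theorem P'_mul_mul_mul_Q' (y : Matrix (Fin r ⊕ Fin (m - r)) (Fin r ⊕ Fin (n - r)) ℂ) :
    F.P' * (F.P * y * F.Q) * F.Q' = y := by
  simp only [Matrix.mul_assoc, F.Q_mul_Q', Matrix.mul_one]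
  rw [← Matrix.mul_assoc, F.P'_mul_P, Matrix.one_mul]

theorem P'_mul_q_mul_Q' : F.P' * q * F.Q' = Matrix.fromBlocks 1 0 0 0 := by
  exact (congrArg (fun z => F.P' * z * F.Q') F.eq).trans (F.P'_mul_mul_mul_Q' _)

/-- With `w = [a b; c 0]` for `P' * v * Q'`, one has
`w = [a 0; c 0] * [1 0; 0 0] + [1 0; 0 0] * [0 b; 0 0]`. -/
theorem exists_eq_mul_add_mul (v : Matrix (Fin m) (Fin n) ℂ)
    (hv : ∀ i j, (F.P' * v * F.Q') (Sum.inr i) (Sum.inr j) = 0) :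
    ∃ (X : Matrix (Fin m) (Fin m) ℂ) (Y : Matrix (Fin n) (Fin n) ℂ), v = X * q + q * Y := by
  set w := F.P' * v * F.Q' with hw
  have hvw : v = F.P * w * F.Q := by
    rw [hw]
    simp only [Matrix.mul_assoc, F.Q'_mul_Q, Matrix.mul_one]
    rw [← Matrix.mul_assoc, F.P_mul_P', Matrix.one_mul]
  have h22 : w.toBlocks₂₂ = 0 := by
    ext i j
    exact hv i j
  let X : Matrix (Fin r ⊕ Fin (m - r)) (Fin r ⊕ Fin (m - r)) ℂ :=
    Matrix.fromBlocks w.toBlocks₁₁ 0 w.toBlocks₂₁ 0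
  let Y : Matrix (Fin r ⊕ Fin (n - r)) (Fin r ⊕ Fin (n - r)) ℂ :=
    Matrix.fromBlocks 0 w.toBlocks₁₂ 0 0
  let E : Matrix (Fin r ⊕ Fin (m - r)) (Fin r ⊕ Fin (n - r)) ℂ := Matrix.fromBlocks 1 0 0 0
  have hwE : w = X * E + E * Y := by
    simp only [X, Y, E]
    rw [Matrix.fromBlocks_multiply, Matrix.fromBlocks_multiply, Matrix.fromBlocks_add]
    conv_lhs => rw [← w.fromBlocks_toBlocks, h22]
    simp
  refine ⟨F.P * X * F.P', F.Q' * Y * F.Q, ?_⟩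
  have h1 : F.P' * q = E * F.Q := by
    refine (congrArg (fun z => F.P' * z) F.eq).trans ?_
    rw [Matrix.mul_assoc, ← Matrix.mul_assoc, F.P'_mul_P, Matrix.one_mul]
  have h2 : q * F.Q' = F.P * E := by
    refine (congrArg (fun z => z * F.Q') F.eq).trans ?_
    rw [Matrix.mul_assoc, F.Q_mul_Q', Matrix.mul_one]
  rw [Matrix.mul_assoc _ F.P' q, h1, Matrix.mul_assoc F.Q', ← Matrix.mul_assoc q, h2]
  conv_lhs => rw [hvw, hwE]
  simp only [Matrix.mul_add, Matrix.add_mul, Matrix.mul_assoc]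

variable {κ : Type*} [Fintype κ] [DecidableEq κ]

/-- The minor of `P' * x * Q'` on the rows `ρ` and the columns `ς`, as a function of `x`. -/
noncomputable def minor (ρ : κ → Fin r ⊕ Fin (m - r)) (ς : κ → Fin r ⊕ Fin (n - r)) :
    Matrix (Fin m) (Fin n) ℂ → ℂ :=
  fun x => ((F.P' * x * F.Q').submatrix ρ ς).det

theorem analyticAt_minor (ρ : κ → Fin r ⊕ Fin (m - r)) (ς : κ → Fin r ⊕ Fin (n - r)) (x) :
    AnalyticAt ℂ (F.minor ρ ς) x :=
  Matrix.analyticAt_det_mul_mul _ _ x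

theorem minor_eq_zero_of_rank_lt (ρ : κ → Fin r ⊕ Fin (m - r)) (ς : κ → Fin r ⊕ Fin (n - r))
    {x : Matrix (Fin m) (Fin n) ℂ} (hx : x.rank < Fintype.card κ) : F.minor ρ ς x = 0 := by
  by_contra hdet
  have h1 := Matrix.rank_of_det_ne_zero hdet
  have h2 := (F.P' * x * F.Q').rank_submatrix_le ρ ς
  rw [h1, F.rank_P'_mul_mul_Q'] at h2
  omega

theorem fderiv_minor (ρ : κ → Fin r ⊕ Fin (m - r)) (ς : κ → Fin r ⊕ Fin (n - r))
    {x : Matrix (Fin m) (Fin n) ℂ} {d : κ → ℂ}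
    (hx : (F.P' * x * F.Q').submatrix ρ ς = Matrix.diagonal d) {o : κ} (ho : d o = 0)
    (v : Matrix (Fin m) (Fin n) ℂ) :
    fderiv ℂ (F.minor ρ ς) x v =
      (∏ k ∈ Finset.univ.erase o, d k) * (F.P' * v * F.Q') (ρ o) (ς o) :=
  Matrix.fderiv_det_mul_mul _ _ x v hx ho

/-- The indices of the identity block of the normal form, followed by one further index `i`. -/
abbrev border {k : ℕ} (i : Fin k) : Fin r ⊕ Unit → Fin r ⊕ Fin k :=
  Sum.elim Sum.inl fun _ => Sum.inr i

theorem fderiv_borderedMinor (i : Fin (m - r)) (j : Fin (n - r)) (v : Matrix (Fin m) (Fin n) ℂ) :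
    fderiv ℂ (F.minor (border i) (border j)) q v = (F.P' * v * F.Q') (Sum.inr i) (Sum.inr j) := by
  have h := F.fderiv_minor (border i) (border j) (x := q) (d := Sum.elim 1 0) (o := Sum.inr ())
    (by
      rw [F.P'_mul_q_mul_Q']
      ext (a | a) (b | b) <;> simp [border, Matrix.one_apply, Matrix.diagonal_apply]) rfl v
  rw [h, Finset.prod_eq_one, one_mul]
  · rfl
  · rintro (k | k) hk
    · rfl
    · simp at hk

theorem entry_eq_zero_of_mem_tangentVectors (v : Matrix (Fin m) (Fin n) ℂ)
    (hv : v ∈ tangentVectors (rankStratum m n r) q) (i : Fin (m - r)) (j : Fin (n - r)) :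
    (F.P' * v * F.Q') (Sum.inr i) (Sum.inr j) = 0 := by
  obtain ⟨γ, hγ, hγ0, hγS, rfl⟩ := hv
  rw [← F.fderiv_borderedMinor]
  have h := fderiv_apply_velocity_eq_zero (f := F.minor (border i) (border j))
    (F.analyticAt_minor _ _ (γ 0)).differentiableAt hγ.differentiableAt.hasDerivAt (by
      filter_upwards [hγS] with t ht
      apply F.minor_eq_zero_of_rank_lt
      have ht' : (γ t).rank = r := ht
      simp [ht'])
  rw [hγ0] at h
  exact h

theorem eventually_mem_rankStratum_iff :
    ∀ᶠ x in 𝓝 q, x ∈ rankStratum m n r ↔ ∀ i j, F.minor (border i) (border j) x = 0 := by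
  have hne : ∀ᶠ x in 𝓝 q, F.minor Sum.inl Sum.inl x ≠ 0 := by
    refine (F.analyticAt_minor Sum.inl Sum.inl q).continuousAt.eventually_ne ?_
    rw [minor, F.P'_mul_q_mul_Q']
    have : (Matrix.fromBlocks 1 0 0 0 :
        Matrix (Fin r ⊕ Fin (m - r)) (Fin r ⊕ Fin (n - r)) ℂ).submatrix Sum.inl Sum.inl = 1 := rfl
    rw [this, Matrix.det_one]
    exact one_ne_zero
  filter_upwards [hne] with x hx
  refine Iff.trans ?_ (Matrix.rank_eq_iff_borderedMinor_eq_zero (F.P' * x * F.Q') hx)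
  rw [F.rank_P'_mul_mul_Q']
  rfl

/-- The bordered minors together are a submersion at `q` with values in a space of dimension
`(m - r) * (n - r)`, and cut out the rank stratum near `q`. -/
theorem exists_submersion (F : RankNormalForm r q) :
    ∃ (k : ℕ) (h : Matrix (Fin m) (Fin n) ℂ → (Fin k → ℂ)),
    AnalyticAt ℂ h q ∧ Function.Surjective (fderiv ℂ h q) ∧
      ∀ᶠ x in 𝓝 q, x ∈ rankStratum m n r ↔ h x = 0 := by
  let e := finProdFinEquiv (m := m - r) (n := n - r)
  let h : Matrix (Fin m) (Fin n) ℂ → (Fin ((m - r) * (n - r)) → ℂ) :=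
    fun x l => F.minor (border (e.symm l).1) (border (e.symm l).2) x
  have han : AnalyticAt ℂ h q := analyticAt_pi_iff.2 fun l => F.analyticAt_minor _ _ q
  refine ⟨_, h, han, fun y => ?_, ?_⟩
  · let w : Matrix (Fin r ⊕ Fin (m - r)) (Fin r ⊕ Fin (n - r)) ℂ :=
      Matrix.fromBlocks 0 0 0 (Matrix.of fun i j => y (e (i, j)))
    refine ⟨F.P * w * F.Q, ?_⟩
    have hd : HasFDerivAt h _ q := hasFDerivAt_pi.2 fun l =>
      (F.analyticAt_minor (border (e.symm l).1) (border (e.symm l).2) q).differentiableAt.hasFDerivAt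
    rw [hd.fderiv]
    funext l
    refine (F.fderiv_borderedMinor _ _ _).trans ?_
    rw [F.P'_mul_mul_mul_Q']
    simp [w]
  · filter_upwards [F.eventually_mem_rankStratum_iff] with x hx
    rw [hx]
    constructor
    · intro H
      funext l
      exact H _ _
    · intro H i j
      have := congrFun H (e (i, j))
      simpa [h] using this

/-- A logarithmic vector field at `q` has no component in the lower right block of the normal form.
The entry at `(i, j)` is isolated by an `s`-minor along a line of matrices of rank less than `s` that
leaves `q`. -/
theorem entry_eq_zero_of_mem_logTangentSpace {s : ℕ} (hrs : r < s) (hs : s ≤ min m n)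
    (v : Matrix (Fin m) (Fin n) ℂ)
    (hv : v ∈ logTangentSpace (genericDeterminantalVariety m n s) q)
    (i : Fin (m - r)) (j : Fin (n - r)) :
    (F.P' * v * F.Q') (Sum.inr i) (Sum.inr j) = 0 := by
  obtain ⟨ξ, ⟨hξ, hlog⟩, rfl⟩ := hv
  change (F.P' * ξ q * F.Q') (Sum.inr i) (Sum.inr j) = 0
  obtain ⟨k, rfl⟩ : ∃ k, s = r + (k + 1) := ⟨s - r - 1, by omega⟩
  obtain ⟨ρ, hρ, hρl, hρi⟩ := exists_injective_index (r := r) (k := k) i (by omega)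
  obtain ⟨ς, hς, hςl, hςj⟩ := exists_injective_index (r := r) (k := k) j (by omega)
  -- The matrix `y t` carries the entries `1`, `t` and `0` of `d t` at the places `(ρ l, ς l)`.
  let d : ℂ → Fin r ⊕ (Fin k ⊕ Unit) → ℂ := fun t =>
    Sum.elim 1 (Sum.elim (fun _ => t) 0)
  let o : Fin r ⊕ (Fin k ⊕ Unit) := Sum.inr (Sum.inr ())
  let y : ℂ → Matrix (Fin r ⊕ Fin (m - r)) (Fin r ⊕ Fin (n - r)) ℂ := fun t =>
    (1 : Matrix _ _ ℂ).submatrix id ρ * Matrix.diagonal (d t) * (1 : Matrix _ _ ℂ).submatrix ς id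
  let x : ℂ → Matrix (Fin m) (Fin n) ℂ := fun t => F.P * y t * F.Q
  have hy0 : y 0 = Matrix.fromBlocks 1 0 0 0 := by
    ext i j
    rcases i with i | i <;> rcases j with j | j <;>
      simp [y, d, Matrix.mul_apply, Matrix.diagonal_apply, Matrix.one_apply, hρl, hςl]
  have hx0 : x 0 = q := by
    simp only [x, hy0]
    exact F.eq.symm
  have hx (t) : (F.P' * x t * F.Q').submatrix ρ ς = Matrix.diagonal (d t) := by
    simp only [x, F.P'_mul_mul_mul_Q']
    have h1 : (1 : Matrix (Fin r ⊕ Fin (m - r)) (Fin r ⊕ Fin (m - r)) ℂ).submatrix ρ ρ = 1 :=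
      Matrix.submatrix_one _ hρ
    have h2 : (1 : Matrix (Fin r ⊕ Fin (n - r)) (Fin r ⊕ Fin (n - r)) ℂ).submatrix ς ς = 1 :=
      Matrix.submatrix_one _ hς
    have h3 : (y t).submatrix ρ ς =
        (1 : Matrix (Fin r ⊕ Fin (m - r)) (Fin r ⊕ Fin (m - r)) ℂ).submatrix ρ ρ *
          Matrix.diagonal (d t) *
          (1 : Matrix (Fin r ⊕ Fin (n - r)) (Fin r ⊕ Fin (n - r)) ℂ).submatrix ς ς := rfl
    rw [h3, h1, h2, Matrix.one_mul, Matrix.mul_one]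
  have hrank (t) : (x t).rank < r + (k + 1) := by
    refine ((Matrix.rank_mul_le_left _ _).trans (Matrix.rank_mul_le_right _ _)).trans_lt ?_
    refine ((Matrix.rank_mul_le_left _ _).trans (Matrix.rank_mul_le_right _ _)).trans_lt ?_
    rw [Matrix.rank_diagonal]
    refine (Fintype.card_subtype_lt (x := o) (by simp [d, o])).trans_eq ?_
    simp
  have hxc : Continuous x := by
    have hd : Continuous d := continuous_pi fun l => by
      rcases l with l | l | l <;> simp only [d, Sum.elim_inl, Sum.elim_inr] <;> fun_prop
    fun_prop
  have hxlim : Tendsto x (𝓝 0) (𝓝 q) := by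
    have := hxc.tendsto 0
    rwa [hx0] at this
  have hf : F.minor ρ ς ∈ vanishingIdealAt (genericDeterminantalVariety m n (r + (k + 1))) q := by
    refine ⟨F.analyticAt_minor ρ ς q,
      Eventually.of_forall fun z hz => F.minor_eq_zero_of_rank_lt ρ ς ?_⟩
    simpa using mem_genericDeterminantalVariety_iff.1 hz
  -- The derivative of the minor at `x t` is `t ^ k` times the entry, and `t ≠ 0`.
  have hzero : ∀ᶠ t in 𝓝[≠] (0 : ℂ), (F.P' * ξ (x t) * F.Q') (Sum.inr i) (Sum.inr j) = 0 := by
    filter_upwards [(hxlim.eventually (hlog _ hf).2).filter_mono nhdsWithin_le_nhds,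
      self_mem_nhdsWithin] with t ht ht0
    have h1 := ht (mem_genericDeterminantalVariety_iff.2 (hrank t))
    have h2 := (F.fderiv_minor ρ ς (hx t) (o := o) rfl (ξ (x t))).symm.trans h1
    rw [hρi, hςj] at h2
    refine (mul_eq_zero.1 h2).resolve_left (Finset.prod_ne_zero_iff.2 ?_)
    rintro (l | l | l) hl
    · exact one_ne_zero
    · exact ht0
    · simp [o] at hl
  have hcont : ContinuousAt (fun t => (F.P' * ξ (x t) * F.Q') (Sum.inr i) (Sum.inr j)) 0 := by
    have h1 : ContinuousAt (fun t => ξ (x t)) 0 :=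
      ContinuousAt.comp (by rw [hx0]; exact hξ.continuousAt) hxc.continuousAt
    have h2 : Continuous fun z : Matrix (Fin m) (Fin n) ℂ =>
        (F.P' * z * F.Q') (Sum.inr i) (Sum.inr j) := by fun_prop
    exact h2.continuousAt.comp h1
  have hlim := hcont.tendsto.mono_left (nhdsWithin_le_nhds (s := {0}ᶜ))
  rw [hx0] at hlim
  exact tendsto_nhds_unique hlim ((tendsto_const_nhds).congr' (hzero.mono fun t ht => ht.symm))

end RankNormalForm

/-! ### The rank stratification -/

theorem mainTheorem3 (m n r s : ℕ) (hrs : r < s) (hs : s ≤ min m n) :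
    IsHolonomicStratum (genericDeterminantalVariety m n s) (rankStratum m n r) := by
  have hF {q : Matrix (Fin m) (Fin n) ℂ} (hq : q ∈ rankStratum m n r) :
      Nonempty (RankNormalForm r q) := by
    obtain rfl : q.rank = r := hq
    exact exists_rankNormalForm q
  refine ⟨fun q hq => ?_, fun q hq => ?_, fun q hq => Set.Subset.antisymm (fun v hv => ?_)
    fun v hv => ?_⟩
  · rw [mem_genericDeterminantalVariety_iff]
    exact (Eq.le hq).trans_lt hrs
  · obtain ⟨F⟩ := hF hq
    exact F.exists_submersion
  · obtain ⟨F⟩ := hF hq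
    obtain ⟨X, Y, rfl⟩ :=
      F.exists_eq_mul_add_mul v (F.entry_eq_zero_of_mem_logTangentSpace hrs hs v hv)
    exact mul_add_mul_mem_tangentVectors hq X Y
  · obtain ⟨F⟩ := hF hq
    obtain ⟨X, Y, rfl⟩ := F.exists_eq_mul_add_mul v (F.entry_eq_zero_of_mem_tangentVectors v hv)
    exact mul_add_mul_mem_logTangentSpace q X Y
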